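/- Let $C$ be an elementary abelian $2$-group of order $2^4$ with a given basis $r_1,\dots,r_4$ (a maximal cube of $\mathrm{Weyl}(\mathsf E_6)$, with its four reflections). The degree of $g\in C$ is the number of $r_i$ occurring in $g$. Identify $H(C)=H^*(C,\mathbf F_2)$ with $\mathbf F_2[x_1,\dots,x_4]$, where $(x_i)$ is the basis of $H^1(C)=\mathrm{Hom}(C,\mathbf Z/2\mathbf Z)$ dual to $(r_i)$, and put $H(C)'=\mathbf F_2[x_1,\dots,x_4,y]/(x_1^2+x_1y,\dots,x_4^2+x_4y)$. Let $\rho:C\to \mathrm{GL}_n(\mathbf R)$ be a real representation whose character is invariant under the permutations of $r_1,\dots,r_4$. For $i=1,\dots,4$ let $m_i$ be the multiplicity of $-1$ as an eigenvalue of $\rho(g_i)$, where $g_i$ is an (arbitrary) element of $C$ of degree $i$. Let $w(\rho)\in H(C)$ be the total Stiefel-Whitney class of $\rho$, i.e. the pullback by $\rho$ of the total Stiefel-Whitney class in $H(B\mathrm{GL}_n(\mathbf R))$; explicitly, $w(\rho)=\prod_\chi(1+[\chi])^{m_\chi(\rho)}$, where $\chi$ runs through the homomorphisms $C\to\{\pm1\}$,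 $m_\chi(\rho)$ is the multiplicity of $\chi$ in $\rho$, and $[\chi]\in H^1(C)$ is the class of $\chi$. Let $w(\rho)'$ be its image in $H(C)'$. Then there are unique polynomials $p_1,\dots,p_4\in\mathbf F_2[y]$ such that $$w(\rho)'=1+\sum_{i=1}^4 s_i(x_1,\dots,x_4)\,p_i(y),$$ where $s_i(x_1,\dots,x_4)$ is the $i$-th elementary symmetric function of the $x_j$, and in $\mathbf F_2[x]$ they satisfy $$x\,p_1(x)=1+(1+x)^{m_1},\qquad x^2p_2(x)=1+(1+x)^{m_2},$$ $$x^3p_3(x)=1+x\,p_1(x)+x^2p_2(x)+(1+x)^{m_3},\qquad x^4p_4(x)=1+(1+x)^{m_4}.$$ -/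

import Mathlib

open Polynomial

noncomputable section

namespace SW

/-! ### Mod 2 cohomology of the classifying space of a topological group

`BG` is taken to be the classifying space of the simplicial group `Sing G`: its `n`-simplices are
the orbits of `(Sing G)_n = C(Δⁿ, G)`, acting by left translations on `(Sing G)_n ^ (n+1)`.  For a
discrete group every map `Δⁿ → G` is constant and this is the usual bar construction. -/

/-- The topological standard simplex of dimension `n`. -/
abbrev Simp (n : ℕ) : Type := stdSimplex ℝ (Fin (n + 1))

/-- The affine map of standard simplices given by a map of vertices. -/
def simpMap {m n : ℕ} (θ : Fin (m + 1) → Fin (n + 1)) : C(Simp m, Simp n) :=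
  ⟨stdSimplex.map θ, stdSimplex.continuous_map θ⟩

/-- The `n`-simplices of the total space `EG`: families of `n + 1` singular simplices of `G`. -/
abbrev ESimplex (G : Type) [TopologicalSpace G] (n : ℕ) : Type :=
  Fin (n + 1) → C(Simp n, G)

/-- The simplicial operator of `EG` attached to a map of vertices: it selects members of the
family and restricts each of them to the corresponding face of `Δⁿ`. -/
def res {G : Type} [TopologicalSpace G] {m n : ℕ} (θ : Fin (m + 1) → Fin (n + 1))
    (σ : ESimplex G n) : ESimplex G m :=
  fun j => (σ (θ j)).comp (simpMap θ)

/-- Total cochains (with components in all degrees) of `EG` with coefficients in `𝔽₂`. Those of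
`BG` are the invariant ones, see `IsInvariant`. -/
def Cochain (G : Type) [TopologicalSpace G] : Type :=
  ∀ n : ℕ, ESimplex G n → ZMod 2

/-- The map of vertices `j ↦ s + j` (values are only used for `s + j ≤ n`). -/
def shift (m n s : ℕ) : Fin (m + 1) → Fin (n + 1) :=
  fun j => ⟨min (s + j) n, by omega⟩

section

variable {G : Type} [TopologicalSpace G]

instance : AddCommGroup (Cochain G) :=
  inferInstanceAs (AddCommGroup (∀ n : ℕ, ESimplex G n → ZMod 2))

/-- The cup product: front face times back face. -/
instance : Mul (Cochain G) where
  mul f g := fun n σ =>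
    ∑ pq ∈ Finset.HasAntidiagonal.antidiagonal n,
      f pq.1 (res (shift pq.1 n 0) σ) * g pq.2 (res (shift pq.2 n pq.1) σ)

/-- The unit: the constant `1` in degree `0`. -/
instance : One (Cochain G) where
  one := fun n _ => if n = 0 then 1 else 0

theorem cochain_mul_apply (f g : Cochain G) (n : ℕ) (σ : ESimplex G n) :
    (f * g) n σ = ∑ pq ∈ Finset.HasAntidiagonal.antidiagonal n,
      f pq.1 (res (shift pq.1 n 0) σ) * g pq.2 (res (shift pq.2 n pq.1) σ) := rfl

theorem cochain_one_apply (n : ℕ) (σ : ESimplex G n) :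
    (1 : Cochain G) n σ = if n = 0 then 1 else 0 := rfl

theorem cochain_add_apply (f g : Cochain G) (n : ℕ) (σ : ESimplex G n) :
    (f + g) n σ = f n σ + g n σ := rfl

theorem cochain_zero_apply (n : ℕ) (σ : ESimplex G n) : (0 : Cochain G) n σ = 0 := rfl

theorem res_res {l m n : ℕ} (θ : Fin (m + 1) → Fin (n + 1)) (η : Fin (l + 1) → Fin (m + 1))
    (σ : ESimplex G n) : res η (res θ σ) = res (θ ∘ η) σ := by
  funext j
  ext x
  simp only [res, simpMap, ContinuousMap.comp_apply, ContinuousMap.coe_mk, Function.comp_apply]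
  rw [stdSimplex.map_comp_apply]

theorem res_id {n : ℕ} (σ : ESimplex G n) : res id σ = σ := by
  funext j
  ext x
  simp only [res, simpMap, ContinuousMap.comp_apply, ContinuousMap.coe_mk, id]
  congr 1
  exact stdSimplex.map_id_apply x

theorem shift_comp {l m n s t : ℕ} (h : t + l ≤ m) :
    shift m n s ∘ shift l m t = shift l n (s + t) := by
  funext j
  have := j.2
  simp only [shift, Function.comp_apply, Fin.mk.injEq]
  have : min (t + (j : ℕ)) m = t + j := by omega
  rw [this, add_assoc]

theorem shift_zero (n : ℕ) : shift n n 0 = id := by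
  funext j
  have := j.2
  ext
  simp only [shift, id, zero_add]
  omega

instance : Ring (Cochain G) :=
  { (inferInstance : AddCommGroup (Cochain G)), (inferInstance : Mul (Cochain G)),
    (inferInstance : One (Cochain G)) with
    left_distrib := fun f g h => by
      funext n σ
      simp only [cochain_mul_apply, cochain_add_apply, mul_add, Finset.sum_add_distrib]
    right_distrib := fun f g h => by
      funext n σ
      simp only [cochain_mul_apply, cochain_add_apply, add_mul, Finset.sum_add_distrib]
    zero_mul := fun f => by
      funext n σ
      simp [cochain_mul_apply, cochain_zero_apply]
    mul_zero := fun f => by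
      funext n σ
      simp [cochain_mul_apply, cochain_zero_apply]
    one_mul := fun f => by
      funext n σ
      rw [cochain_mul_apply, Finset.sum_eq_single (0, n)]
      · simp [cochain_one_apply, shift_zero, res_id]
      · rintro ⟨p, q⟩ h h'
        have : p ≠ 0 := by
          rintro rfl
          simp only [Finset.HasAntidiagonal.mem_antidiagonal] at h
          exact h' (by simp at h; simp [h])
        simp [cochain_one_apply, this]
      · simp
    mul_one := fun f => by
      funext n σ
      rw [cochain_mul_apply, Finset.sum_eq_single (n, 0)]
      · simp [cochain_one_apply, shift_zero, res_id]
      · rintro ⟨p, q⟩ h h'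
        have : q ≠ 0 := by
          rintro rfl
          simp only [Finset.HasAntidiagonal.mem_antidiagonal] at h
          exact h' (by simp at h; simp [h])
        simp [cochain_one_apply, this]
      · simp
    mul_assoc := fun f g h => by
      funext n σ
      simp only [cochain_mul_apply, Finset.sum_mul, Finset.mul_sum, Finset.sum_sigma', res_res]
      refine Finset.sum_nbij' (fun x => ⟨(x.2.1, x.2.2 + x.1.2), (x.2.2, x.1.2)⟩)
        (fun x => ⟨(x.1.1 + x.2.1, x.2.2), (x.1.1, x.2.1)⟩) ?_ ?_ ?_ ?_ ?_
      · rintro ⟨⟨a, b⟩, ⟨c, d⟩⟩ h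
        simp only [Finset.mem_sigma, Finset.HasAntidiagonal.mem_antidiagonal] at h ⊢
        exact ⟨by omega, trivial⟩
      · rintro ⟨⟨a, b⟩, ⟨c, d⟩⟩ h
        simp only [Finset.mem_sigma, Finset.HasAntidiagonal.mem_antidiagonal] at h ⊢
        exact ⟨by omega, trivial⟩
      · rintro ⟨⟨a, b⟩, ⟨c, d⟩⟩ h
        simp only [Finset.mem_sigma, Finset.HasAntidiagonal.mem_antidiagonal] at h
        obtain ⟨h1, rfl⟩ := h
        rfl
      · rintro ⟨⟨a, b⟩, ⟨c, d⟩⟩ h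
        simp only [Finset.mem_sigma, Finset.HasAntidiagonal.mem_antidiagonal] at h
        obtain ⟨h1, rfl⟩ := h
        rfl
      · rintro ⟨⟨a, b⟩, ⟨c, d⟩⟩ h
        simp only [Finset.mem_sigma, Finset.HasAntidiagonal.mem_antidiagonal] at h
        obtain ⟨h1, rfl⟩ := h
        simp only
        rw [shift_comp (by omega), shift_comp (by omega), shift_comp (by omega),
          shift_comp (by omega), mul_assoc]
        simp only [zero_add, add_zero] }

/-- The coboundary of a total cochain (no signs mod 2). -/
def coboundary (f : Cochain G) : Cochain G
  | 0, _ => 0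
  | n + 1, σ => ∑ i : Fin (n + 2), f n (res (Fin.succAbove i) σ)

/-- `f` is a cochain of `BG`: it is invariant under left translations by `(Sing G)_n`. -/
def IsInvariant [Group G] [IsTopologicalGroup G] (f : Cochain G) : Prop :=
  ∀ (n : ℕ) (τ : C(Simp n, G)) (σ : ESimplex G n), f n (fun j => τ * σ j) = f n σ

/-- `f` is a cocycle of `BG`. -/
def IsCocycle [Group G] [IsTopologicalGroup G] (f : Cochain G) : Prop :=
  IsInvariant f ∧ coboundary f = 0

/-- Two cocycles of `BG` define the same class in `H(BG)`. -/
def Cohomologous [Group G] [IsTopologicalGroup G] (f g : Cochain G) : Prop :=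
  ∃ b : Cochain G, IsInvariant b ∧ f - g = coboundary b

/-- The pullback of cochains along a continuous homomorphism. -/
def pullback {K : Type} [TopologicalSpace K] [Group G] [Group K] (φ : G →ₜ* K)
    (f : Cochain K) : Cochain G :=
  fun n σ => f n (fun j => (⟨φ, φ.continuous_toFun⟩ : C(G, K)).comp (σ j))

end

/-! ### Stiefel-Whitney classes -/

/-- The elementary abelian 2-group `{±1}ⁿ`. -/
abbrev Signs (n : ℕ) : Type := Fin n → ℤˣ

/-- The cocycle of degree `1` on `{±1}ⁿ` of the `i`-th coordinate homomorphism to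
`{±1} ≃ ℤ/2`, in homogeneous form `(g₀, g₁) ↦ [g₀⁻¹ g₁]ᵢ`. -/
def coordClass (n : ℕ) (i : Fin n) : Cochain (Signs n)
  | 1, σ => if σ 0 (stdSimplex.vertex 0) i = σ 1 (stdSimplex.vertex 0) i then 0 else 1
  | _, _ => 0

/-- The inclusion of `{±1}ⁿ` in `GL_n(ℝ)` as diagonal matrices. -/
def diagSigns (n : ℕ) : Signs n →* GL (Fin n) ℝ where
  toFun ε := ⟨Matrix.diagonal fun i => ((ε i : ℤ) : ℝ), Matrix.diagonal fun i => ((ε i : ℤ) : ℝ),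
    by
      rw [Matrix.diagonal_mul_diagonal, ← Matrix.diagonal_one]
      congr 1; funext i
      rcases Int.units_eq_one_or (ε i) with h | h <;> simp [h],
    by
      rw [Matrix.diagonal_mul_diagonal, ← Matrix.diagonal_one]
      congr 1; funext i
      rcases Int.units_eq_one_or (ε i) with h | h <;> simp [h]⟩
  map_one' := by ext i j; simp
  map_mul' ε ε' := by
    apply Units.ext
    simp [Matrix.diagonal_mul_diagonal]

instance (n : ℕ) : DiscreteTopology (Signs n) := inferInstance

/-- A homomorphism from the finite discrete group `{±1}ⁿ` is continuous. -/
def toContinuous {n : ℕ} {K : Type} [TopologicalSpace K] [Group K] (φ : Signs n →* K) :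
    Signs n →ₜ* K :=
  { φ with continuous_toFun := continuous_of_discreteTopology }

/-- `c` represents the total Stiefel-Whitney class `1 + w₁ + ⋯ + w_n` in
`H(B GL_n(ℝ)) = H(B O_n(ℝ)) = 𝔽₂[w₁, …, w_n]`. Restriction to the diagonal subgroup `{±1}ⁿ` embeds
this ring in `𝔽₂[t₁, …, t_n]`, and the total class is the one that restricts to
`(1 + t₁) ⋯ (1 + t_n)`. -/
def IsUniversalStiefelWhitney (n : ℕ) (c : Cochain (GL (Fin n) ℝ)) : Prop :=
  IsCocycle c ∧
    Cohomologous (pullback (toContinuous (diagSigns n)) c)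
      (List.ofFn fun j : Fin n => 1 + coordClass n j).prod

/-- The cube `C`, written in its basis of reflections: `s_i` has `i`-th coordinate `-1` and the
other ones `1`. -/
abbrev Cube : Type := Signs 4

/-- The degree of an element of the cube: the number of reflections `s_i` that occur in it. -/
def deg (g : Cube) : ℕ := (Finset.univ.filter fun i => g i = -1).card

/-- `H(C) = 𝔽₂[x₁, …, x₄]`, where `x_i ∈ H¹(C) = Hom(C, ℤ/2)` is the dual basis of `s_i`. -/
abbrev HC : Type := MvPolynomial (Fin 4) (ZMod 2)

/-- The map from `𝔽₂[x₁, …, x₄]` to cocycles of `BC` inducing the isomorphism onto `H(C)`: a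
polynomial is a sum of monomials (the coefficients are `0` or `1`), each of which is sent to the
corresponding cup product. -/
def toCochain (W : HC) : Cochain Cube :=
  ∑ a ∈ W.support, (List.ofFn fun i : Fin 4 => coordClass 4 i ^ a i).prod

section

variable {n : ℕ}

/-- The multiplicity in `ρ` of the character `χ_J(g) = ∏_{i ∈ J} g_i` of `C`. -/
def charMult (ρ : Cube →* GL (Fin n) ℝ) (J : Finset (Fin 4)) : ℕ :=
  Module.finrank ℝ
    (⨅ g : Cube, Module.End.eigenspace (Matrix.toLin' (ρ g : Matrix (Fin n) (Fin n) ℝ))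
      (∏ i ∈ J, ((g i : ℤ) : ℝ)) : Submodule ℝ (Fin n → ℝ))

/-- The total Stiefel-Whitney class `w(ρ) ∈ H(C) = 𝔽₂[x₁, …, x₄]`. As `C` is elementary abelian,
`ρ` is a direct sum of characters, `w(ρ)` is the product of their classes, and
`w(χ_J) = 1 + [χ_J] = 1 + ∑_{i ∈ J} x_i`. -/
def totalSW (ρ : Cube →* GL (Fin n) ℝ) : HC :=
  ∏ J : Finset (Fin 4), (1 + ∑ i ∈ J, MvPolynomial.X i) ^ charMult ρ J

/-- The multiplicity of `-1` as an eigenvalue of `ρ(g)`. -/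
def negMult (ρ : Cube →* GL (Fin n) ℝ) (g : Cube) : ℕ :=
  Module.finrank ℝ
    (Module.End.eigenspace (Matrix.toLin' (ρ g : Matrix (Fin n) (Fin n) ℝ)) (-1))

/-- The character of `ρ` is invariant under the permutations of the four reflections. -/
def IsSymmetricCharacter (ρ : Cube →* GL (Fin n) ℝ) : Prop :=
  ∀ (π : Equiv.Perm (Fin 4)) (g : Cube),
    Matrix.trace (ρ (g ∘ π) : Matrix (Fin n) (Fin n) ℝ) =
      Matrix.trace (ρ g : Matrix (Fin n) (Fin n) ℝ)

end

/-! ### The modified cohomology ring -/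

/-- The ideal of `H(C)[y]` generated by the `x_i² + x_i y`. -/
def modIdeal : Ideal HC[X] :=
  Ideal.span (Set.range fun i : Fin 4 => C (MvPolynomial.X i) ^ 2 + C (MvPolynomial.X i) * X)

/-- `H(C)' = 𝔽₂[x₁, …, x₄, y] / (x_i² + x_i y)`. -/
abbrev HC' : Type := HC[X] ⧸ modIdeal

/-- The natural map `H(C) → H(C)'`. -/
def toHC' : HC →+* HC' := (Ideal.Quotient.mk modIdeal).comp C

/-- The element `y` of `H(C)'`. -/
def y : HC' := Ideal.Quotient.mk modIdeal X

/-- The image of the elementary symmetric function `s_i` in `H(C)'`. -/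
def s (i : ℕ) : HC' := toHC' (MvPolynomial.esymm (Fin 4) (ZMod 2) i)

/-- The identity `z = 1 + s₁ p₁(y) + ⋯ + s₄ p₄(y)` in `H(C)'`; the polynomial `p_i` is
`p (i - 1)`. -/
def IsExpansion (z : HC') (p : Fin 4 → (ZMod 2)[X]) : Prop :=
  z = 1 + ∑ i : Fin 4, s (i + 1) * aeval y (p i)

end SW

end

/-!
The statement has two independent halves.

*The pullback of the universal class.* A real representation `ρ` of the cube is a direct sum of
characters `χ_{J 1}, …, χ_{J n}` (`exists_isEigenbasis`), so that `ρ` is conjugate, by a fixed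
element of `GL_n(ℝ)`, to the composite of a homomorphism `C → {±1}ⁿ` with the diagonal inclusion.
Conjugate homomorphisms have the same effect on cohomology
(`cohomologous_pullback_of_conj`): invariant cochains do not see left translations, and right
translation by an element of the group is homotopic to the identity by the usual prism operator.
Hence the pullback of the universal class is the cup product of the cocycles
`1 + ∑_{i ∈ J j} x_i`. The cup product is associative but not commutative on cochains, whereas
`toCochain` writes the factors of a monomial in a fixed order; the two agree up to coboundaries
since classes of degree one commute up to the coboundary of their cup-1-product
(`cohomologous_charClass_mul_comm`, `exists_cocycle_toCochain`).

*The expansion in `H(C)'`.* For `I ⊆ {1, …, 4}` there is a homomorphism `H(C)' → 𝔽₂[y]` with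
`x_i ↦ y` for `i ∈ I` and `x_i ↦ 0` otherwise (`evalAt`). If `g` is the product of the reflections
in `I`, a character contributes to the image of `w(ρ)` the factor `1 + y` if it takes the value
`-1` at `g`, and `1` otherwise, so that the image is `(1 + y) ^ m` with `m` the multiplicity of
`-1` in `ρ(g)` (`evalAt_totalSW`). The image of `s_i` is `binom(|I|, i) y ^ i`, and reading these
binomial coefficients mod 2 for `|I| = 1, 2, 3, 4` gives the four identities, hence uniqueness
(`IsExpansion.coeff_eq`). For existence, the multiplicities of the characters in `ρ` are determined
by the trace of `ρ`, so that `w(ρ)` is a symmetric polynomial. In `H(C)'` a monomial is a squarefree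
monomial times a power of `y`, and by symmetry the coefficients in `𝔽₂[y]` of squarefree monomials
of the same degree can be chosen equal (`exists_expansion`).
-/

noncomputable section

namespace SW

/-! ### Faces, degeneracies and the coboundary -/

section

variable {G : Type} [TopologicalSpace G]

/-- The map of vertices that omits the value `k`. The index `k` is a natural number, so that sums
over faces are sums over `Finset.range`; values are only meaningful for `n = m + 1`. -/
def face (m n k : ℕ) : Fin (m + 1) → Fin (n + 1) :=
  fun j => ⟨min (if (j : ℕ) < k then (j : ℕ) else j + 1) n, by omega⟩

/-- The map of vertices that takes the value `k` twice. -/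
def degen (m n k : ℕ) : Fin (m + 1) → Fin (n + 1) :=
  fun j => ⟨min (if (j : ℕ) ≤ k then (j : ℕ) else j - 1) n, by omega⟩

theorem succAbove_eq_face {n : ℕ} (i : Fin (n + 2)) :
    (Fin.succAbove i : Fin (n + 1) → Fin (n + 2)) = face n (n + 1) i := by
  funext j
  ext
  have := j.2
  simp only [Fin.succAbove, face, Fin.lt_def, Fin.val_castSucc]
  split_ifs <;> simp
  omega

theorem coboundary_succ (f : Cochain G) (n : ℕ) (σ : ESimplex G (n + 1)) :
    coboundary f (n + 1) σ = ∑ k ∈ Finset.range (n + 2), f n (res (face n (n + 1) k) σ) := by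
  rw [← Fin.sum_univ_eq_sum_range fun k => f n (res (face n (n + 1) k) σ)]
  simp only [coboundary, succAbove_eq_face]

theorem coboundary_zero_degree (f : Cochain G) (σ : ESimplex G 0) : coboundary f 0 σ = 0 := rfl

theorem coboundary_add (f g : Cochain G) :
    coboundary (f + g) = coboundary f + coboundary g := by
  funext n σ
  cases n with
  | zero => simp [cochain_add_apply, coboundary_zero_degree]
  | succ n => simp [cochain_add_apply, coboundary_succ, Finset.sum_add_distrib]

theorem coboundary_zero : coboundary (0 : Cochain G) = 0 := by
  simpa using coboundary_add (0 : Cochain G) 0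

theorem coboundary_one : coboundary (1 : Cochain G) = 0 := by
  funext n σ
  rcases n with _ | _ | n
  · rfl
  · simp only [coboundary_succ, cochain_one_apply, cochain_zero_apply]
    decide
  · simp [coboundary_succ, cochain_one_apply, cochain_zero_apply]

/-- The Leibniz rule. Among the faces of a simplex, those with index at most `p` are faces of the
front face of dimension `p + 1`, and the other ones are faces of the back face that starts at the
vertex `p`; the two remaining terms of the right hand side cancel mod 2. -/
theorem coboundary_mul (f g : Cochain G) :
    coboundary (f * g) = coboundary f * g + f * coboundary g := by
  funext n σ
  cases n with
  | zero => simp [cochain_add_apply, cochain_mul_apply, coboundary_zero_degree]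
  | succ n =>
    rw [cochain_add_apply, cochain_mul_apply, cochain_mul_apply, coboundary_succ]
    simp only [cochain_mul_apply, res_res]
    rw [Finset.Nat.sum_antidiagonal_succ, Finset.Nat.sum_antidiagonal_succ', Finset.sum_comm]
    simp only [coboundary_zero_degree, zero_mul, mul_zero, zero_add,
      ← Finset.sum_add_distrib]
    refine Finset.sum_congr rfl ?_
    rintro ⟨p, q⟩ h
    obtain rfl : p + q = n := by simpa using h
    simp only [coboundary_succ, res_res]
    rw [show Finset.range (p + q + 2) = Finset.range ((p + 1) + (q + 1)) from
      congrArg _ (by omega), Finset.sum_range_add,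
      Finset.sum_range_succ (n := p + 1), Finset.sum_range_succ' (n := q + 1), add_mul, mul_add,
      Finset.sum_mul, Finset.mul_sum]
    have key : ∀ a b c d e e' : ZMod 2, a = c → b = d → e = e' →
        a + b = c + e + (d + e') := by decide
    refine key _ _ _ _ _ _ (Finset.sum_congr rfl fun k hk => ?_)
      (Finset.sum_congr rfl fun k hk => ?_) ?_
    all_goals
      first | rw [Finset.mem_range] at hk | skip
      congr 3 <;>
      · funext j
        have := j.2
        ext
        simp only [face, shift, Function.comp_apply]
        grind

end

/-! ### The cohomology ring -/

section

variable {G : Type} [TopologicalSpace G]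

instance : Module (ZMod 2) (Cochain G) :=
  inferInstanceAs (Module (ZMod 2) (∀ n : ℕ, ESimplex G n → ZMod 2))

theorem cochain_smul_apply (r : ZMod 2) (f : Cochain G) (n : ℕ) (σ : ESimplex G n) :
    (r • f) n σ = r * f n σ := rfl

instance : Algebra (ZMod 2) (Cochain G) :=
  Algebra.ofModule
    (fun r f g => by
      funext n σ
      simp only [cochain_smul_apply, cochain_mul_apply, Finset.mul_sum, mul_assoc])
    (fun r f g => by
      funext n σ
      simp only [cochain_smul_apply, cochain_mul_apply, Finset.mul_sum, mul_left_comm])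

theorem coboundary_smul (r : ZMod 2) (f : Cochain G) :
    coboundary (r • f) = r • coboundary f := by
  funext n σ
  cases n with
  | zero => simp [cochain_smul_apply, coboundary_zero_degree]
  | succ n => simp only [cochain_smul_apply, coboundary_succ, Finset.mul_sum]

theorem coboundary_pullback [Group G] {K : Type} [TopologicalSpace K] [Group K]
    (φ : G →ₜ* K) (f : Cochain K) :
    coboundary (pullback φ f) = pullback φ (coboundary f) := by
  funext n σ
  cases n <;> rfl

variable [Group G] [IsTopologicalGroup G]

theorem IsInvariant.add {f g : Cochain G} (hf : IsInvariant f) (hg : IsInvariant g) :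
    IsInvariant (f + g) := fun n τ σ => by
  rw [cochain_add_apply, hf, hg, cochain_add_apply]

theorem IsInvariant.smul {f : Cochain G} (r : ZMod 2) (hf : IsInvariant f) :
    IsInvariant (r • f) := fun n τ σ => by
  rw [cochain_smul_apply, hf, cochain_smul_apply]

theorem res_left_mul {m n : ℕ} (θ : Fin (m + 1) → Fin (n + 1)) (τ : C(Simp n, G))
    (σ : ESimplex G n) :
    res θ (fun j => τ * σ j) = fun j => τ.comp (simpMap θ) * res θ σ j := rfl

theorem IsInvariant.mul {f g : Cochain G} (hf : IsInvariant f) (hg : IsInvariant g) :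
    IsInvariant (f * g) := fun n τ σ => by
  simp only [cochain_mul_apply, res_left_mul]
  exact Finset.sum_congr rfl fun pq _ => by rw [hf, hg]

theorem isInvariant_one : IsInvariant (1 : Cochain G) := fun _ _ _ => rfl

variable (G) in
/-- The algebra of cocycles of `BG`. -/
def cocycles : Subalgebra (ZMod 2) (Cochain G) where
  carrier := {f | IsCocycle f}
  add_mem' := fun ⟨hf, hf'⟩ ⟨hg, hg'⟩ => ⟨hf.add hg, by rw [coboundary_add, hf', hg', add_zero]⟩
  mul_mem' := fun ⟨hf, hf'⟩ ⟨hg, hg'⟩ =>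
    ⟨hf.mul hg, by rw [coboundary_mul, hf', hg', zero_mul, mul_zero, add_zero]⟩
  algebraMap_mem' r := by
    rw [Algebra.algebraMap_eq_smul_one]
    exact ⟨isInvariant_one.smul r, by rw [coboundary_smul, coboundary_one, smul_zero]⟩

theorem cohomologous_of_eq {f g : Cochain G} (h : f = g) : Cohomologous f g :=
  ⟨0, fun _ _ _ => rfl, by rw [h, sub_self, coboundary_zero]⟩

theorem Cohomologous.trans {f g h : Cochain G} :
    Cohomologous f g → Cohomologous g h → Cohomologous f h := by
  rintro ⟨b, hb, hb'⟩ ⟨c, hc, hc'⟩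
  exact ⟨b + c, hb.add hc, by rw [coboundary_add, ← hb', ← hc', sub_add_sub_cancel]⟩

theorem Cohomologous.symm {f g : Cochain G} : Cohomologous f g → Cohomologous g f := by
  rintro ⟨b, hb, hb'⟩
  exact ⟨(-1 : ZMod 2) • b, hb.smul _, by
    rw [coboundary_smul, ← hb', neg_smul, one_smul, neg_sub]⟩

theorem Cohomologous.add {f f' g g' : Cochain G} :
    Cohomologous f f' → Cohomologous g g' → Cohomologous (f + g) (f' + g') := by
  rintro ⟨b, hb, hb'⟩ ⟨c, hc, hc'⟩
  exact ⟨b + c, hb.add hc, by rw [coboundary_add, ← hb', ← hc', add_sub_add_comm]⟩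

theorem Cohomologous.mul {f f' g g' : Cochain G} (hf' : IsCocycle f') (hg : IsCocycle g) :
    Cohomologous f f' → Cohomologous g g' → Cohomologous (f * g) (f' * g') := by
  rintro ⟨b, hb, hb'⟩ ⟨c, hc, hc'⟩
  refine ⟨b * g + f' * c, (hb.mul hg.1).add (hf'.1.mul hc), ?_⟩
  rw [coboundary_add, coboundary_mul, coboundary_mul, hg.2, hf'.2, ← hb', ← hc']
  noncomm_ring

variable (G) in
/-- Cohomology as a congruence on the algebra of cocycles. -/
def cohomologyCon : RingCon (cocycles G) where
  r f g := Cohomologous (f : Cochain G) g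
  iseqv := ⟨fun _ => cohomologous_of_eq rfl, Cohomologous.symm, Cohomologous.trans⟩
  add' := Cohomologous.add
  mul' {_ f' g _} h h' := h.mul f'.2 g.2 h'

variable (G) in
/-- The cohomology ring of `BG` with coefficients in `𝔽₂`. -/
abbrev Cohomology : Type := (cohomologyCon G).Quotient

variable (G) in
/-- The class of a cocycle. -/
def cohomologyClass : cocycles G →+* Cohomology G := (cohomologyCon G).mk'

theorem cohomologyClass_eq {f g : cocycles G} :
    cohomologyClass G f = cohomologyClass G g ↔ Cohomologous (f : Cochain G) g :=
  (cohomologyCon G).eq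

/-! ### Functoriality -/

variable {K : Type} [TopologicalSpace K] [Group K] [IsTopologicalGroup K]

/-- The pullback along a continuous homomorphism as a ring homomorphism. -/
def pullbackHom (φ : G →ₜ* K) : Cochain K →+* Cochain G where
  toFun := pullback φ
  map_one' := rfl
  map_zero' := rfl
  map_add' _ _ := rfl
  map_mul' _ _ := rfl

theorem IsInvariant.pullback {f : Cochain K} (hf : IsInvariant f) (φ : G →ₜ* K) :
    IsInvariant (pullback φ f) := fun n τ σ => by
  refine Eq.trans (congrArg (f n) ?_) (hf n ((⟨φ, φ.continuous_toFun⟩ : C(G, K)).comp τ) _)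
  funext j
  ext x
  exact map_mul φ _ _

theorem Cohomologous.pullback {f g : Cochain K} (φ : G →ₜ* K) :
    Cohomologous f g → Cohomologous (pullback φ f) (pullback φ g) := by
  rintro ⟨b, hb, hb'⟩
  refine ⟨SW.pullback φ b, hb.pullback φ, ?_⟩
  rw [coboundary_pullback, ← hb']
  exact ((pullbackHom φ).map_sub f g).symm

/-! ### Inner automorphisms act trivially on cohomology -/

/-- The simplex obtained by multiplying on the right by `a` the members of index at least `t`. -/
def translateFrom (a : G) (t : ℕ) {n : ℕ} (σ : ESimplex G n) : ESimplex G n :=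
  fun j => if (j : ℕ) < t then σ j else σ j * ContinuousMap.const _ a

theorem res_translateFrom (a : G) {t t' m n : ℕ} (θ : Fin (m + 1) → Fin (n + 1))
    (σ : ESimplex G n) (h : ∀ j, (θ j : ℕ) < t ↔ (j : ℕ) < t') :
    res θ (translateFrom a t σ) = translateFrom a t' (res θ σ) := by
  funext j
  simp only [res, translateFrom, h]
  split_ifs <;> rfl

theorem translateFrom_left_mul (a : G) (t : ℕ) {n : ℕ} (τ : C(Simp n, G)) (σ : ESimplex G n) :
    translateFrom a t (fun j => τ * σ j) = fun j => τ * translateFrom a t σ j := by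
  funext j
  simp only [translateFrom]
  split_ifs
  · rfl
  · rw [mul_assoc]

/-- The `i`-th simplex `(σ₀, …, σ_i, σ_i a, …, σ_n a)` of the prism that joins a simplex to its
right translate by `a`. -/
def prism (a : G) (i : ℕ) {n : ℕ} (σ : ESimplex G n) : ESimplex G (n + 1) :=
  translateFrom a (i + 1) (res (degen (n + 1) n i) σ)

theorem res_face_prism_of_lt (a : G) {i k n : ℕ} (hk : k < i) (hi : i ≤ n + 1)
    (σ : ESimplex G (n + 1)) :
    res (face (n + 1) (n + 2) k) (prism a i σ) = prism a (i - 1) (res (face n (n + 1) k) σ) := by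
  rw [prism, prism, res_translateFrom (t' := i - 1 + 1), res_res, res_res]
  · congr 2
    funext j
    ext
    simp only [face, degen, Function.comp_apply]
    grind
  · intro j
    simp only [face]
    grind

theorem res_face_prism_of_gt (a : G) {i k n : ℕ} (hk : i + 1 < k) (hk' : k ≤ n + 2)
    (σ : ESimplex G (n + 1)) :
    res (face (n + 1) (n + 2) k) (prism a i σ) = prism a i (res (face n (n + 1) (k - 1)) σ) := by
  rw [prism, prism, res_translateFrom (t' := i + 1), res_res, res_res]
  · congr 2
    funext j
    ext
    simp only [face, degen, Function.comp_apply]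
    grind
  · intro j
    simp only [face]
    grind

theorem res_face_prism_inner (a : G) {i k n : ℕ} (hk : k = i ∨ k = i + 1)
    (σ : ESimplex G n) :
    res (face n (n + 1) k) (prism a i σ) = translateFrom a k σ := by
  rw [prism, res_translateFrom (t' := k), res_res]
  · conv_rhs => rw [← res_id σ]
    congr 2
    funext j
    ext
    simp only [face, degen, Function.comp_apply, id]
    grind
  · intro j
    simp only [face]
    grind

/-- The sum over the faces of all simplices of a prism: the inner faces are the terms `F i i` and
`F i (i + 1)`, and the outer faces are the prisms over the faces of the base. -/
theorem sum_prism_faces {M : Type*} [AddCommMonoid M] (n : ℕ) (F H : ℕ → ℕ → M)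
    (hlt : ∀ i k, k < i → i ≤ n → F i k = H k (i - 1))
    (hgt : ∀ i k, i + 1 < k → k ≤ n + 1 → F i k = H (k - 1) i) :
    ∑ i ∈ Finset.range (n + 1), ∑ k ∈ Finset.range (n + 2), F i k =
      ∑ i ∈ Finset.range (n + 1), (F i i + F i (i + 1)) +
        ∑ k ∈ Finset.range (n + 1), ∑ i ∈ Finset.range n, H k i := by
  have h1 : ∀ i ∈ Finset.range (n + 1), ∑ k ∈ Finset.range (n + 2), F i k =
      (F i i + F i (i + 1)) + (∑ k ∈ Finset.range (n + 2), (if k < i then F i k else 0) +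
        ∑ k ∈ Finset.range (n + 2), (if i + 1 < k then F i k else 0)) := by
    intro i hi
    rw [Finset.mem_range] at hi
    have h2 : F i i = ∑ k ∈ Finset.range (n + 2), if k = i then F i k else 0 := by
      rw [Finset.sum_ite_eq', if_pos (by simp; omega)]
    have h3 : F i (i + 1) = ∑ k ∈ Finset.range (n + 2), if k = i + 1 then F i k else 0 := by
      rw [Finset.sum_ite_eq', if_pos (by simp; omega)]
    rw [h2, h3, ← Finset.sum_add_distrib, ← Finset.sum_add_distrib, ← Finset.sum_add_distrib]
    refine Finset.sum_congr rfl fun k _ => ?_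
    rcases lt_trichotomy k i with h | h | h
    · simp [h, h.ne, show k ≠ i + 1 by omega, show ¬ i + 1 < k by omega]
    · simp [h]
    · rcases eq_or_ne k (i + 1) with h' | h'
      · simp [h']
      · simp [h', h.ne', show ¬ k < i by omega, show i + 1 < k by omega]
  have h2 : ∑ i ∈ Finset.range (n + 1), ∑ k ∈ Finset.range (n + 2), (if k < i then F i k else 0) =
      ∑ k ∈ Finset.range (n + 1), ∑ i ∈ Finset.range n, if k ≤ i then H k i else 0 := by
    rw [Finset.sum_range_succ', Finset.sum_comm (s := Finset.range (n + 1))]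
    simp only [not_lt_zero, if_false, Finset.sum_const_zero, add_zero]
    refine Finset.sum_congr rfl fun i hi => ?_
    rw [Finset.mem_range] at hi
    rw [Finset.sum_range_succ, if_neg (by omega), add_zero]
    refine Finset.sum_congr rfl fun k _ => ?_
    simp only [Nat.lt_succ_iff]
    split_ifs with h
    · exact hlt _ _ (by omega) (by omega)
    · rfl
  have h3 : ∑ i ∈ Finset.range (n + 1), ∑ k ∈ Finset.range (n + 2),
      (if i + 1 < k then F i k else 0) =
      ∑ k ∈ Finset.range (n + 1), ∑ i ∈ Finset.range n, if k ≤ i then 0 else H k i := by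
    rw [Finset.sum_comm, Finset.sum_range_succ']
    simp only [not_lt_zero, if_false, Finset.sum_const_zero, add_zero]
    refine Finset.sum_congr rfl fun k hk => ?_
    rw [Finset.mem_range] at hk
    rw [Finset.sum_range_succ, if_neg (by omega), add_zero]
    refine Finset.sum_congr rfl fun i _ => ?_
    split_ifs with h h'
    · omega
    · exact hgt _ _ (by omega) (by omega)
    · rfl
    · omega
  rw [Finset.sum_congr rfl h1, Finset.sum_add_distrib, Finset.sum_add_distrib (f := fun i =>
    ∑ k ∈ Finset.range (n + 2), if k < i then F i k else 0), h2, h3, ← Finset.sum_add_distrib]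
  congr 1
  refine Finset.sum_congr rfl fun k _ => ?_
  rw [← Finset.sum_add_distrib]
  refine Finset.sum_congr rfl fun i _ => ?_
  split_ifs <;> simp

/-- Right translation by an element of `G` acts on the simplices of `BG`, and this action is trivial
on cohomology: the prism operator is a homotopy to the identity. -/
theorem cohomologous_right_translate {c : Cochain G} (hc : IsCocycle c) (a : G) :
    Cohomologous (fun n σ => c n (fun j => σ j * ContinuousMap.const _ a) : Cochain G) c := by
  refine ⟨fun n σ => ∑ i ∈ Finset.range (n + 1), c (n + 1) (prism a i σ), fun n τ σ => ?_, ?_⟩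
  · refine Finset.sum_congr rfl fun i _ => ?_
    rw [prism, res_left_mul, translateFrom_left_mul, hc.1, prism]
  · set b : Cochain G := fun n σ => ∑ i ∈ Finset.range (n + 1), c (n + 1) (prism a i σ)
    funext n σ
    have h0 : ∑ i ∈ Finset.range (n + 1), ∑ k ∈ Finset.range (n + 2),
        c n (res (face n (n + 1) k) (prism a i σ)) = 0 := by
      refine Finset.sum_eq_zero fun i _ => ?_
      rw [← coboundary_succ, hc.2]
      rfl
    have hinner : ∑ i ∈ Finset.range (n + 1), (c n (res (face n (n + 1) i) (prism a i σ)) +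
        c n (res (face n (n + 1) (i + 1)) (prism a i σ))) =
        c n (fun j => σ j * ContinuousMap.const _ a) - c n σ := by
      have htel := Finset.sum_range_sub' (fun i => c n (translateFrom a i σ)) (n + 1)
      have e1 : translateFrom a (n + 1) σ = σ := by
        funext j
        exact if_pos j.2
      have e0 : translateFrom a 0 σ = fun j => σ j * ContinuousMap.const _ a := rfl
      rw [e1, e0] at htel
      rw [← htel]
      refine Finset.sum_congr rfl fun i _ => ?_
      rw [res_face_prism_inner a (Or.inl rfl), res_face_prism_inner a (Or.inr rfl), CharTwo.sub_eq_add]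
    change c n _ - c n σ = _
    rw [← hinner]
    obtain ⟨H, hlt, hgt, houter⟩ : ∃ H : ℕ → ℕ → ZMod 2,
        (∀ i k, k < i → i ≤ n → c n (res (face n (n + 1) k) (prism a i σ)) = H k (i - 1)) ∧
        (∀ i k, i + 1 < k → k ≤ n + 1 →
          c n (res (face n (n + 1) k) (prism a i σ)) = H (k - 1) i) ∧
        coboundary b n σ = ∑ k ∈ Finset.range (n + 1), ∑ i ∈ Finset.range n, H k i := by
      cases n with
      | zero => exact ⟨0, by omega, by omega, by simp [coboundary_zero_degree]⟩
      | succ m =>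
        refine ⟨fun k i => c (m + 1) (prism a i (res (face m (m + 1) k) σ)),
          fun i k hk hi => ?_, fun i k hk hk' => ?_, coboundary_succ b m σ⟩
        · rw [res_face_prism_of_lt a hk hi]
        · rw [res_face_prism_of_gt a hk hk']
    rw [houter, ← CharTwo.add_eq_zero, ← h0]
    exact (sum_prism_faces n (fun i k => c n (res (face n (n + 1) k) (prism a i σ))) H hlt
      hgt).symm

/-- Conjugate homomorphisms induce the same map in cohomology. -/
theorem cohomologous_pullback_of_conj {c : Cochain K} (hc : IsCocycle c) {φ ψ : G →ₜ* K} (a : K)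
    (h : ∀ g, φ g = a * ψ g * a⁻¹) : Cohomologous (pullback φ c) (pullback ψ c) := by
  refine Cohomologous.trans (cohomologous_of_eq ?_)
    ((cohomologous_right_translate hc a⁻¹).pullback ψ)
  funext n σ
  refine Eq.trans (congrArg (c n) ?_) (hc.1 n (ContinuousMap.const _ a) _)
  funext j
  ext x
  exact (h _).trans (mul_assoc _ _ _)

end

/-! ### Classes of degree one of elementary abelian 2-groups -/

section

variable {n : ℕ}

/-- The isomorphism `{±1} ≃ ℤ/2`. -/
def signBit (u : ℤˣ) : ZMod 2 := if u = 1 then 0 else 1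

theorem signBit_mul : ∀ u v : ℤˣ, signBit (u * v) = signBit u + signBit v := by decide

theorem signBit_one : signBit 1 = 0 := rfl

/-- The member of index `j` of a simplex of `E{±1}ⁿ`, which is constant on the simplex. -/
def vertexValue {m : ℕ} (σ : ESimplex (Signs n) m) (j : Fin (m + 1)) : Signs n :=
  σ j (stdSimplex.vertex 0)

theorem vertexValue_res {l m : ℕ} (θ : Fin (l + 1) → Fin (m + 1)) (σ : ESimplex (Signs n) m)
    (j : Fin (l + 1)) : vertexValue (res θ σ) j = vertexValue σ (θ j) :=
  PreconnectedSpace.constant inferInstance (σ (θ j)).continuous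

/-- The cocycle of degree `1` of a homomorphism `χ` from `{±1}ⁿ` to `{±1} ≃ ℤ/2`. -/
def charClass (χ : Signs n →* ℤˣ) : Cochain (Signs n)
  | 1, σ => signBit (χ (vertexValue σ 0)) + signBit (χ (vertexValue σ 1))
  | _, _ => 0

theorem coordClass_eq_charClass (i : Fin n) :
    coordClass n i = charClass (Pi.evalMonoidHom (fun _ : Fin n => ℤˣ) i) := by
  have h : ∀ u v : ℤˣ, (if u = v then 0 else 1) = signBit u + signBit v := by decide
  funext m σ
  rcases m with _ | _ | m
  · rfl
  · exact h _ _
  · rfl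

theorem charClass_of_ne_one (χ : Signs n →* ℤˣ) {m : ℕ} (hm : m ≠ 1) (σ : ESimplex (Signs n) m) :
    charClass χ m σ = 0 := by
  rcases m with _ | _ | m
  · rfl
  · exact absurd rfl hm
  · rfl

theorem charClass_res (χ : Signs n →* ℤˣ) {m : ℕ} (θ : Fin 2 → Fin (m + 1))
    (σ : ESimplex (Signs n) m) :
    charClass χ 1 (res θ σ) =
      signBit (χ (vertexValue σ (θ 0))) + signBit (χ (vertexValue σ (θ 1))) := by
  rw [charClass, vertexValue_res, vertexValue_res]

theorem coboundary_two (f : Cochain (Signs n)) (σ : ESimplex (Signs n) 2) :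
    coboundary f 2 σ = f 1 (res (Fin.succAbove (0 : Fin 3)) σ) +
      f 1 (res (Fin.succAbove (1 : Fin 3)) σ) + f 1 (res (Fin.succAbove (2 : Fin 3)) σ) :=
  Fin.sum_univ_three fun i : Fin 3 => f 1 (res (Fin.succAbove i) σ)

theorem coboundary_of_ne_two {f : Cochain (Signs n)} (hf : ∀ m ≠ 1, ∀ σ, f m σ = 0) {m : ℕ}
    (hm : m ≠ 2) (σ : ESimplex (Signs n) m) : coboundary f m σ = 0 := by
  cases m with
  | zero => rfl
  | succ m => exact Finset.sum_eq_zero fun _ _ => hf _ (by omega) _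

theorem isCocycle_charClass (χ : Signs n →* ℤˣ) : IsCocycle (charClass χ) := by
  refine ⟨fun m τ σ => ?_, ?_⟩
  · by_cases hm : m = 1
    · subst hm
      have hτ : vertexValue (fun j => τ * σ j) 0 = τ (stdSimplex.vertex 0) * vertexValue σ 0 := rfl
      have hτ' : vertexValue (fun j => τ * σ j) 1 = τ (stdSimplex.vertex 0) * vertexValue σ 1 := rfl
      rw [charClass, charClass, hτ, hτ', map_mul, map_mul, signBit_mul, signBit_mul]
      generalize signBit (χ _) = a
      generalize signBit (χ _) = b
      generalize signBit (χ _) = c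
      revert a b c
      decide
    · rw [charClass_of_ne_one χ hm, charClass_of_ne_one χ hm]
  · funext m σ
    by_cases hm : m = 2
    · subst hm
      rw [coboundary_two]
      simp only [charClass_res]
      change signBit (χ (vertexValue σ 1)) + signBit (χ (vertexValue σ 2)) +
        (signBit (χ (vertexValue σ 0)) + signBit (χ (vertexValue σ 2))) +
        (signBit (χ (vertexValue σ 0)) + signBit (χ (vertexValue σ 1))) = 0
      generalize signBit (χ _) = a
      generalize signBit (χ _) = b
      generalize signBit (χ _) = c
      revert a b c
      decide
    · exact coboundary_of_ne_two (fun m hm σ => charClass_of_ne_one χ hm σ) hm σ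

theorem charClass_mul (χ χ' : Signs n →* ℤˣ) :
    charClass (χ * χ') = charClass χ + charClass χ' := by
  funext m σ
  rw [cochain_add_apply]
  by_cases hm : m = 1
  · subst hm
    simp only [charClass, MonoidHom.mul_apply, signBit_mul]
    abel
  · simp only [charClass_of_ne_one _ hm, add_zero]

theorem charClass_one : charClass (1 : Signs n →* ℤˣ) = 0 := by
  simpa using charClass_mul (1 : Signs n →* ℤˣ) 1

theorem charClass_prod {ι : Type*} (J : Finset ι) (χ : ι → Signs n →* ℤˣ) :
    charClass (∏ i ∈ J, χ i) = ∑ i ∈ J, charClass (χ i) := by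
  classical
  induction J using Finset.induction_on with
  | empty => simp [charClass_one]
  | insert i J hi ih => rw [Finset.prod_insert hi, Finset.sum_insert hi, charClass_mul, ih]

theorem pullback_charClass {m : ℕ} (φ : Signs m →* Signs n) (χ : Signs n →* ℤˣ) :
    pullback (toContinuous φ) (charClass χ) = charClass (χ.comp φ) := by
  funext k σ
  rcases k with _ | _ | k <;> rfl

theorem charClass_cup_apply (χ χ' : Signs n →* ℤˣ) {m : ℕ} (hm : m ≠ 2)
    (σ : ESimplex (Signs n) m) : (charClass χ * charClass χ') m σ = 0 := by
  rw [cochain_mul_apply]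
  refine Finset.sum_eq_zero fun pq h => ?_
  rw [Finset.HasAntidiagonal.mem_antidiagonal] at h
  by_cases hp : pq.1 = 1
  · rw [charClass_of_ne_one χ' (by omega), mul_zero]
  · rw [charClass_of_ne_one χ hp, zero_mul]

/-- Classes of degree `1` commute: the cup-1-product, which is their product as functions of an
edge, bounds the commutator. -/
theorem cohomologous_charClass_mul_comm (χ χ' : Signs n →* ℤˣ) :
    Cohomologous (charClass χ * charClass χ') (charClass χ' * charClass χ) := by
  have hinv := fun ω : Signs n →* ℤˣ => (isCocycle_charClass ω).1
  refine ⟨fun m σ => charClass χ m σ * charClass χ' m σ, fun m τ σ => ?_, ?_⟩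
  · exact congrArg₂ (· * ·) (hinv χ m τ σ) (hinv χ' m τ σ)
  · funext m σ
    change (charClass χ * charClass χ') m σ - (charClass χ' * charClass χ) m σ = _
    by_cases hm : m = 2
    · subst hm
      refine Eq.trans ?_ (coboundary_two _ σ).symm
      simp only [cochain_mul_apply,
        Finset.Nat.sum_antidiagonal_eq_sum_range_succ_mk, Finset.sum_range_succ,
        Finset.sum_range_zero, charClass_of_ne_one _ (show (0 : ℕ) ≠ 1 by decide),
        charClass_of_ne_one _ (show (2 : ℕ) ≠ 1 by decide), mul_zero, zero_add, add_zero,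
        Nat.reduceSub, charClass_res]
      change (signBit (χ (vertexValue σ 0)) + signBit (χ (vertexValue σ 1))) *
          (signBit (χ' (vertexValue σ 1)) + signBit (χ' (vertexValue σ 2))) -
        (signBit (χ' (vertexValue σ 0)) + signBit (χ' (vertexValue σ 1))) *
          (signBit (χ (vertexValue σ 1)) + signBit (χ (vertexValue σ 2))) =
        (signBit (χ (vertexValue σ 1)) + signBit (χ (vertexValue σ 2))) *
          (signBit (χ' (vertexValue σ 1)) + signBit (χ' (vertexValue σ 2))) +
        (signBit (χ (vertexValue σ 0)) + signBit (χ (vertexValue σ 2))) *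
          (signBit (χ' (vertexValue σ 0)) + signBit (χ' (vertexValue σ 2))) +
        (signBit (χ (vertexValue σ 0)) + signBit (χ (vertexValue σ 1))) *
          (signBit (χ' (vertexValue σ 0)) + signBit (χ' (vertexValue σ 1)))
      generalize signBit (χ (vertexValue σ 0)) = a
      generalize signBit (χ (vertexValue σ 1)) = b
      generalize signBit (χ (vertexValue σ 2)) = c
      generalize signBit (χ' (vertexValue σ 0)) = a'
      generalize signBit (χ' (vertexValue σ 1)) = b'
      generalize signBit (χ' (vertexValue σ 2)) = c'
      revert a b c a' b' c'
      decide
    · rw [charClass_cup_apply _ _ hm, charClass_cup_apply _ _ hm, sub_zero]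
      refine (coboundary_of_ne_two (fun m hm σ => ?_) hm σ).symm
      rw [charClass_of_ne_one χ hm, zero_mul]

end

/-! ### Polynomials as cohomology classes of the cube -/

/-- The coordinate classes `x_i`, as cocycles. -/
def coordCocycle (i : Fin 4) : cocycles Cube :=
  ⟨coordClass 4 i, by rw [coordClass_eq_charClass]; exact isCocycle_charClass _⟩

/-- The coordinate classes in the cohomology ring of the cube. -/
def coordCohomology (i : Fin 4) : Cohomology Cube := cohomologyClass Cube (coordCocycle i)

theorem coordCohomology_mul_comm (i j : Fin 4) :
    coordCohomology i * coordCohomology j = coordCohomology j * coordCohomology i := by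
  rw [coordCohomology, coordCohomology, ← map_mul, ← map_mul, cohomologyClass_eq]
  simpa only [coordCocycle, MulMemClass.mk_mul_mk, coordClass_eq_charClass] using
    cohomologous_charClass_mul_comm _ _

/-- The commutative subring of the cohomology ring generated by the coordinate classes. -/
abbrev CoordRing : Type := Algebra.adjoin (ZMod 2) (Set.range coordCohomology)

instance : IsMulCommutative CoordRing :=
  Algebra.isMulCommutative_adjoin (ZMod 2) (by
    rintro _ ⟨i, rfl⟩ _ ⟨j, rfl⟩
    exact coordCohomology_mul_comm i j)

open scoped IsMulCommutative in
/-- The ring homomorphism `𝔽₂[x₁, …, x₄] → H(C)`. -/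
def polyClass : HC →+* Cohomology Cube :=
  (Subalgebra.val (Algebra.adjoin (ZMod 2) (Set.range coordCohomology))).toRingHom.comp
    (MvPolynomial.aeval (R := ZMod 2) (S₁ := CoordRing) fun i =>
      ⟨coordCohomology i, Algebra.subset_adjoin ⟨i, rfl⟩⟩ : HC →ₐ[ZMod 2] CoordRing).toRingHom

open scoped IsMulCommutative in
theorem polyClass_X (i : Fin 4) : polyClass (MvPolynomial.X i) = coordCohomology i := by
  simp [polyClass]

/-- `toCochain` represents the value of the ring homomorphism `polyClass`; in particular it is
multiplicative up to coboundaries. -/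
theorem exists_cocycle_toCochain (W : HC) :
    ∃ h : IsCocycle (toCochain W), cohomologyClass Cube ⟨toCochain W, h⟩ = polyClass W := by
  set z : cocycles Cube :=
    ∑ a ∈ W.support, (List.ofFn fun i : Fin 4 => coordCocycle i ^ a i).prod with hz
  have hzW : (z : Cochain Cube) = toCochain W := by
    simp [hz, toCochain, coordCocycle]
  refine ⟨hzW ▸ z.2, ?_⟩
  have : (⟨toCochain W, hzW ▸ z.2⟩ : cocycles Cube) = z := Subtype.ext hzW.symm
  rw [this]
  conv_rhs => rw [W.as_sum]
  rw [hz, map_sum, map_sum]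
  refine Finset.sum_congr rfl fun a ha => ?_
  have h1 : MvPolynomial.coeff a W = 1 := by
    have := MvPolynomial.mem_support_iff.1 ha
    revert this
    generalize MvPolynomial.coeff a W = r
    revert r
    decide
  rw [h1, MvPolynomial.monomial_eq, Finsupp.prod_fintype _ _ (by simp), ← List.prod_ofFn, map_mul,
    map_list_prod, map_list_prod, List.map_ofFn, List.map_ofFn]
  simp [polyClass_X, coordCohomology, Function.comp_def]

/-! ### Real representations of the cube -/

/-- The character `χ_J(g) = ∏_{i ∈ J} g_i` of the cube. -/
def cubeChar (J : Finset (Fin 4)) : Cube →* ℤˣ :=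
  ∏ i ∈ J, Pi.evalMonoidHom (fun _ : Fin 4 => ℤˣ) i

theorem cubeChar_apply (J : Finset (Fin 4)) (g : Cube) : cubeChar J g = ∏ i ∈ J, g i := by
  simp [cubeChar, MonoidHom.finsetProd_apply]

theorem prod_cast_eq_cubeChar (J : Finset (Fin 4)) (g : Cube) :
    ∏ i ∈ J, ((g i : ℤ) : ℝ) = ((cubeChar J g : ℤ) : ℝ) := by
  rw [cubeChar_apply, Units.coe_prod, Int.cast_prod]

theorem cubeChar_cast_mul_self (J : Finset (Fin 4)) (g : Cube) :
    ((cubeChar J g : ℤ) : ℝ) * ((cubeChar J g : ℤ) : ℝ) = 1 := by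
  rw [← Int.cast_mul, ← Units.val_mul, Int.units_mul_self, Units.val_one, Int.cast_one]

theorem cubeChar_mulSingle (J : Finset (Fin 4)) (i : Fin 4) :
    cubeChar J (Pi.mulSingle i (-1)) = if i ∈ J then -1 else 1 := by
  rw [cubeChar_apply]
  simp only [Pi.mulSingle_apply, Finset.prod_ite_eq']

theorem cubeChar_injective : Function.Injective cubeChar := by
  intro J K h
  ext i
  have h' := DFunLike.congr_fun h (Pi.mulSingle i (-1))
  rw [cubeChar_mulSingle, cubeChar_mulSingle] at h'
  by_cases h1 : i ∈ J <;> by_cases h2 : i ∈ K <;> simp_all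

theorem cubeChar_cast_eq_iff {J K : Finset (Fin 4)} :
    (∀ g, ((cubeChar J g : ℤ) : ℝ) = ((cubeChar K g : ℤ) : ℝ)) ↔ J = K := by
  refine ⟨fun h => cubeChar_injective (MonoidHom.ext fun g => ?_), fun h _ => by rw [h]⟩
  have := h g
  exact Units.ext (by exact_mod_cast this)

/-- Orthogonality of the characters of the cube. -/
theorem sum_cubeChar_mul (J K : Finset (Fin 4)) :
    ∑ g : Cube, ((cubeChar J g : ℤ) : ℝ) * ((cubeChar K g : ℤ) : ℝ) =
      if J = K then 16 else 0 := by
  classical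
  have h := sum_hom_units (((Int.castRingHom ℝ : ℤ →* ℝ).comp (Units.coeHom ℤ)).comp
    (cubeChar J * cubeChar K))
  have hcard : Fintype.card Cube = 16 := by simp [Cube, Signs]
  rw [hcard] at h
  have h1 : ((Int.castRingHom ℝ : ℤ →* ℝ).comp (Units.coeHom ℤ)).comp
    (cubeChar J * cubeChar K) = 1 ↔ J = K := by
    rw [← cubeChar_cast_eq_iff, DFunLike.ext_iff]
    refine forall_congr' fun g => ?_
    have hJ := cubeChar_cast_mul_self J g
    have hK := cubeChar_cast_mul_self K g
    simp only [MonoidHom.comp_apply, MonoidHom.mul_apply, Units.coeHom_apply,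
      MonoidHom.one_apply, MonoidHom.coe_coe, map_mul, eq_intCast]
    constructor
    · intro h
      linear_combination (-((cubeChar J g : ℤ) : ℝ)) * hK + ((cubeChar K g : ℤ) : ℝ) * h
    · intro h
      rw [h, hK]
  simpa [h1, MonoidHom.comp_apply] using h

/-- The dual orthogonality relation. -/
theorem sum_cubeChar (g : Cube) :
    ∑ J : Finset (Fin 4), ((cubeChar J g : ℤ) : ℝ) = if g = 1 then 16 else 0 := by
  have h := Finset.prod_one_add (s := Finset.univ) (f := fun i => ((g i : ℤ) : ℝ))
  rw [Finset.powerset_univ] at h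
  simp only [prod_cast_eq_cubeChar] at h
  rw [← h]
  split_ifs with hg
  · subst hg
    norm_num
  · obtain ⟨i, hi⟩ := Function.ne_iff.1 hg
    refine Finset.prod_eq_zero (Finset.mem_univ i) ?_
    rw [(Int.units_eq_one_or (g i)).resolve_left hi]
    norm_num

/-- If a family of endomorphisms is diagonal in a common basis, then the dimension of a joint
eigenspace is the number of basis vectors in it. -/
theorem finrank_iInf_eigenspace {k V ι κ : Type*} [Field k] [AddCommGroup V] [Module k V]
    [Fintype ι] (b : Module.Basis ι k V) (f : κ → Module.End k V) (a : κ → ι → k) (μ : κ → k)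
    (h : ∀ l j, f l (b j) = a l j • b j) [DecidablePred fun j => ∀ l, a l j = μ l] :
    Module.finrank k (⨅ l, Module.End.eigenspace (f l) (μ l) : Submodule k V) =
      (Finset.univ.filter fun j => ∀ l, a l j = μ l).card := by
  have hrepr : ∀ l v j, b.repr (f l v) j = a l j * b.repr v j := by
    intro l v j
    have : b.coord j ∘ₗ f l = a l j • b.coord j := by
      refine b.ext fun i => ?_
      by_cases hij : i = j
      · subst hij
        simp [h]
      · simp [h, hij]
    simpa using LinearMap.congr_fun this v
  have hspan : (⨅ l, Module.End.eigenspace (f l) (μ l) : Submodule k V) =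
      Submodule.span k (Set.range fun j : {j // ∀ l, a l j = μ l} => b j) := by
    have : (Set.range fun j : {j // ∀ l, a l j = μ l} => b j) = b '' {j | ∀ l, a l j = μ l} := by
      ext v
      simp
    rw [this]
    ext v
    rw [b.mem_span_image, Submodule.mem_iInf]
    simp only [Module.End.mem_eigenspace_iff]
    constructor
    · intro hv j hj l
      have h1 := hrepr l v j
      rw [hv l, map_smul, Finsupp.smul_apply, smul_eq_mul] at h1
      exact (mul_right_cancel₀ (by simpa using hj) h1).symm
    · intro hv l
      refine b.repr.injective (Finsupp.ext fun j => ?_)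
      rw [hrepr, map_smul, Finsupp.smul_apply, smul_eq_mul]
      by_cases hj : b.repr v j = 0
      · rw [hj, mul_zero, mul_zero]
      · rw [hv (by simpa using hj) l]
  rw [hspan]
  exact (finrank_span_eq_card (b.linearIndependent.comp _ Subtype.val_injective)).trans
    (Fintype.card_subtype _)

section

variable {n : ℕ} (ρ : Cube →* GL (Fin n) ℝ)

/-- `ρ` is the direct sum of the characters `χ_{J j}`, on the lines spanned by the vectors
`b j`. -/
def IsEigenbasis (b : Module.Basis (Fin n) ℝ (Fin n → ℝ)) (J : Fin n → Finset (Fin 4)) : Prop :=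
  ∀ g j, Matrix.toLin' (ρ g : Matrix (Fin n) (Fin n) ℝ) (b j) =
    ((cubeChar (J j) g : ℤ) : ℝ) • b j

/-- A real representation of the cube is a direct sum of characters: every vector is the sum of
its projections `1/16 ∑_g χ_J(g) ρ(g) v` to the isotypic components. -/
theorem exists_isEigenbasis : ∃ b J, IsEigenbasis ρ b J := by
  set s : Set (Fin n → ℝ) := {v | ∃ J : Finset (Fin 4), ∀ g,
    Matrix.toLin' (ρ g : Matrix (Fin n) (Fin n) ℝ) v = ((cubeChar J g : ℤ) : ℝ) • v}
  have hspan : ⊤ ≤ Submodule.span ℝ s := by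
    intro v _
    have hP : ∀ J : Finset (Fin 4), ∑ g : Cube, ((cubeChar J g : ℤ) : ℝ) •
        Matrix.toLin' (ρ g : Matrix (Fin n) (Fin n) ℝ) v ∈ Submodule.span ℝ s := by
      refine fun J => Submodule.subset_span ⟨J, fun h => ?_⟩
      rw [map_sum, Finset.smul_sum]
      conv_rhs => rw [← Equiv.sum_comp (Equiv.mulLeft h)]
      refine Finset.sum_congr rfl fun g _ => ?_
      rw [map_smul, Equiv.coe_mulLeft, map_mul, map_mul, Units.val_mul, Units.val_mul,
        Matrix.toLin'_mul, LinearMap.comp_apply, smul_smul, Int.cast_mul, ← mul_assoc,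
        cubeChar_cast_mul_self, one_mul]
    have hsum : ∑ J : Finset (Fin 4), ∑ g : Cube, ((cubeChar J g : ℤ) : ℝ) •
        Matrix.toLin' (ρ g : Matrix (Fin n) (Fin n) ℝ) v = (16 : ℝ) • v := by
      rw [Finset.sum_comm]
      simp only [← Finset.sum_smul, sum_cubeChar, ite_smul, zero_smul]
      simp
    have hv : v = (16 : ℝ)⁻¹ • ∑ J : Finset (Fin 4), ∑ g : Cube, ((cubeChar J g : ℤ) : ℝ) •
        Matrix.toLin' (ρ g : Matrix (Fin n) (Fin n) ℝ) v := by
      rw [hsum, smul_smul]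
      norm_num
    rw [hv]
    exact Submodule.smul_mem _ _ (Submodule.sum_mem _ fun J _ => hP J)
  set b := (Module.Basis.ofSpan hspan).reindex
    ((Module.Basis.ofSpan hspan).indexEquiv (Pi.basisFun ℝ (Fin n)))
  have hb : ∀ j, b j ∈ s := fun j =>
    Module.Basis.ofSpan_subset hspan (by simp [b])
  choose J hJ using hb
  exact ⟨b, J, fun g j => hJ j g⟩

variable {ρ} {b : Module.Basis (Fin n) ℝ (Fin n → ℝ)} {J : Fin n → Finset (Fin 4)}

theorem IsEigenbasis.charMult_eq (h : IsEigenbasis ρ b J) (K : Finset (Fin 4)) :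
    charMult ρ K = (Finset.univ.filter fun j => J j = K).card := by
  classical
  rw [charMult, finrank_iInf_eigenspace b _ (fun g j => ((cubeChar (J j) g : ℤ) : ℝ)) _ h]
  simp only [prod_cast_eq_cubeChar, cubeChar_cast_eq_iff]

theorem IsEigenbasis.negMult_eq (h : IsEigenbasis ρ b J) (g : Cube) :
    negMult ρ g = (Finset.univ.filter fun j => cubeChar (J j) g = -1).card := by
  classical
  have := finrank_iInf_eigenspace b
    (fun _ : Unit => Matrix.toLin' (ρ g : Matrix (Fin n) (Fin n) ℝ))
    (fun _ j => ((cubeChar (J j) g : ℤ) : ℝ)) (fun _ => -1) (fun _ => h g)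
  rw [iInf_const] at this
  rw [negMult, this]
  congr 1
  refine Finset.filter_congr fun j _ => ?_
  rw [forall_const, ← Units.val_inj, Units.val_neg, Units.val_one]
  norm_cast

theorem IsEigenbasis.trace_eq (h : IsEigenbasis ρ b J) (g : Cube) :
    Matrix.trace (ρ g : Matrix (Fin n) (Fin n) ℝ) = ∑ j, ((cubeChar (J j) g : ℤ) : ℝ) := by
  rw [← Matrix.trace_toLin'_eq, LinearMap.trace_eq_matrix_trace ℝ b, Matrix.trace]
  refine Finset.sum_congr rfl fun j _ => ?_
  rw [Matrix.diag_apply, LinearMap.toMatrix_apply, h g j]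
  simp

theorem IsEigenbasis.totalSW_eq (h : IsEigenbasis ρ b J) :
    totalSW ρ = ∏ j, (1 + ∑ i ∈ J j, MvPolynomial.X i) := by
  rw [totalSW, ← Finset.prod_fiberwise' Finset.univ J
    (fun K => (1 + ∑ i ∈ K, MvPolynomial.X i : HC))]
  refine Finset.prod_congr rfl fun K _ => ?_
  rw [Finset.prod_const, h.charMult_eq]

variable (ρ) in
/-- The multiplicities of the characters are determined by the character of `ρ`. -/
theorem charMult_eq_sum_trace (K : Finset (Fin 4)) :
    (16 : ℝ) * charMult ρ K = ∑ g : Cube, ((cubeChar K g : ℤ) : ℝ) *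
      Matrix.trace (ρ g : Matrix (Fin n) (Fin n) ℝ) := by
  obtain ⟨b, J, h⟩ := exists_isEigenbasis ρ
  simp only [h.trace_eq, Finset.mul_sum]
  rw [Finset.sum_comm]
  simp only [sum_cubeChar_mul, h.charMult_eq, Finset.sum_ite, Finset.sum_const_zero, add_zero,
    Finset.sum_const, nsmul_eq_mul]
  rw [mul_comm]
  simp only [eq_comm]

theorem IsSymmetricCharacter.charMult_map (hρ : IsSymmetricCharacter ρ) (π : Equiv.Perm (Fin 4))
    (K : Finset (Fin 4)) : charMult ρ (K.map π.toEmbedding) = charMult ρ K := by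
  have h : (16 : ℝ) * charMult ρ (K.map π.toEmbedding) = 16 * charMult ρ K := by
    rw [charMult_eq_sum_trace, charMult_eq_sum_trace]
    conv_rhs => rw [← Equiv.sum_comp (Equiv.arrowCongr π.symm (Equiv.refl ℤˣ))]
    refine Finset.sum_congr rfl fun g _ => ?_
    have hg : Equiv.arrowCongr π.symm (Equiv.refl ℤˣ) g = g ∘ π := rfl
    rw [hg, hρ π g, cubeChar_apply, cubeChar_apply, Finset.prod_map]
    rfl
  exact_mod_cast mul_left_cancel₀ (by norm_num) h

/-! ### The Stiefel-Whitney class of a representation of the cube -/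

/-- The homomorphism of the cube to `{±1}ⁿ` with coordinates `χ_{J j}`. -/
def signsHom (J : Fin n → Finset (Fin 4)) : Cube →* Signs n :=
  MonoidHom.pi fun j => cubeChar (J j)

theorem IsEigenbasis.exists_conj (h : IsEigenbasis ρ b J) :
    ∃ A : GL (Fin n) ℝ, ∀ g, ρ g = A * diagSigns n (signsHom J g) * A⁻¹ := by
  have hA := (Pi.basisFun ℝ (Fin n)).invertibleToMatrix b
  refine ⟨unitOfInvertible ((Pi.basisFun ℝ (Fin n)).toMatrix b), fun g => ?_⟩
  rw [eq_mul_inv_iff_mul_eq]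
  apply Units.ext
  ext i j
  have := congrFun (h g j) i
  rw [Matrix.toLin'_apply] at this
  simp only [Units.val_mul, val_unitOfInvertible, diagSigns, MonoidHom.coe_mk, OneHom.coe_mk,
    Matrix.mul_apply (M := (ρ g : Matrix (Fin n) (Fin n) ℝ)), Module.Basis.toMatrix_apply,
    Pi.basisFun_repr]
  rw [Matrix.mul_diagonal, Module.Basis.toMatrix_apply, Pi.basisFun_repr, mul_comm]
  exact this

theorem pullback_prod_one_add_coordClass (J : Fin n → Finset (Fin 4)) :
    pullback (toContinuous (signsHom J)) (List.ofFn fun j : Fin n => 1 + coordClass n j).prod =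
      (List.ofFn fun j : Fin n => 1 + ∑ i ∈ J j, coordClass 4 i).prod := by
  change pullbackHom (toContinuous (signsHom J)) _ = _
  refine (map_list_prod (pullbackHom (toContinuous (signsHom J))) _).trans ?_
  rw [List.map_ofFn]
  congr 2
  funext j
  rw [Function.comp_apply, map_add, map_one]
  congr 1
  change pullback (toContinuous (signsHom J)) (coordClass n j) = _
  rw [coordClass_eq_charClass, pullback_charClass]
  simp only [coordClass_eq_charClass]
  rw [← charClass_prod]
  rfl

variable (ρ) in
/-- The pullback along `ρ` of the universal total Stiefel-Whitney class is `totalSW ρ`: up to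
conjugation, `ρ` factors through the diagonal subgroup `{±1}ⁿ`. -/
theorem cohomologous_pullback_universal {c : Cochain (GL (Fin n) ℝ)}
    (hc : IsUniversalStiefelWhitney n c) :
    Cohomologous (pullback (toContinuous ρ) c) (toCochain (totalSW ρ)) := by
  obtain ⟨b, J, h⟩ := exists_isEigenbasis ρ
  obtain ⟨A, hA⟩ := h.exists_conj
  refine (cohomologous_pullback_of_conj hc.1
    (ψ := toContinuous ((diagSigns n).comp (signsHom J))) A hA).trans ?_
  refine (hc.2.pullback (toContinuous (signsHom J))).trans ?_
  rw [pullback_prod_one_add_coordClass]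
  obtain ⟨hW, hclass⟩ := exists_cocycle_toCochain (totalSW ρ)
  set z : cocycles Cube := (List.ofFn fun j : Fin n => 1 + ∑ i ∈ J j, coordCocycle i).prod with hz
  have hz' : (z : Cochain Cube) =
      (List.ofFn fun j : Fin n => 1 + ∑ i ∈ J j, coordClass 4 i).prod := by
    simp [hz, coordCocycle, List.map_ofFn, Function.comp_def]
  rw [← hz']
  refine (cohomologyClass_eq (g := ⟨toCochain (totalSW ρ), hW⟩)).1 ?_
  rw [hclass, h.totalSW_eq, ← List.prod_ofFn, hz, map_list_prod, map_list_prod, List.map_ofFn,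
    List.map_ofFn]
  simp [Function.comp_def, polyClass_X, coordCohomology]

end

/-! ### The modified cohomology ring and its points -/

/-- If `f : A → S` and `c : S` satisfy `f(x_i)² + f(x_i) c = 0`, then they define a homomorphism
from `A[X] / (x_i² + x_i X)` to `S`. -/
def quotientHom {A S ι : Type*} [CommRing A] [CommRing S] (x : ι → A) (f : A →+* S) (c : S)
    (h : ∀ i, f (x i) ^ 2 + f (x i) * c = 0) :
    A[X] ⧸ Ideal.span (Set.range fun i => C (x i) ^ 2 + C (x i) * X) →+* S :=
  Ideal.Quotient.lift _ (eval₂RingHom f c) fun w hw => by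
    refine (Ideal.span_le.2 ?_ : _ ≤ RingHom.ker (eval₂RingHom f c)) hw
    rintro _ ⟨i, rfl⟩
    rw [SetLike.mem_coe, RingHom.mem_ker, map_add, map_pow, map_mul, coe_eval₂RingHom, eval₂_C,
      eval₂_X]
    exact h i

/-- The point of `H(C)'` with values in `𝔽₂[y]` at which `x_i` is `y` for `i ∈ I` and `0`
otherwise. -/
def evalAt (I : Finset (Fin 4)) : HC' →+* (ZMod 2)[X] :=
  quotientHom MvPolynomial.X
    (MvPolynomial.eval₂Hom C fun i => if i ∈ I then (X : (ZMod 2)[X]) else 0) X fun i => by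
    rw [MvPolynomial.coe_eval₂Hom, MvPolynomial.eval₂_X]
    split_ifs
    · rw [← sq, CharTwo.add_self_eq_zero]
    · ring

theorem evalAt_toHC' (I : Finset (Fin 4)) (W : HC) :
    evalAt I (toHC' W) =
      MvPolynomial.eval₂Hom C (fun i => if i ∈ I then (X : (ZMod 2)[X]) else 0) W :=
  eval₂_C _ _

theorem evalAt_y (I : Finset (Fin 4)) : evalAt I y = X :=
  eval₂_X _ _

theorem evalAt_aeval_y (I : Finset (Fin 4)) (p : (ZMod 2)[X]) : evalAt I (aeval y p) = p := by
  rw [aeval_def, hom_eval₂, evalAt_y, Subsingleton.elim ((evalAt I).comp _) C, eval₂_C_X]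

theorem evalAt_s (I : Finset (Fin 4)) (k : ℕ) :
    evalAt I (s k) = (I.card.choose k : (ZMod 2)[X]) * X ^ k := by
  rw [s, evalAt_toHC', MvPolynomial.esymm, map_sum]
  simp only [map_prod, MvPolynomial.coe_eval₂Hom, MvPolynomial.eval₂_X, Finset.prod_ite_zero,
    Finset.prod_const]
  rw [← Finset.sum_filter]
  have hfilter : (Finset.powersetCard k Finset.univ).filter (fun t => ∀ i ∈ t, i ∈ I) =
      Finset.powersetCard k I := by
    ext t
    simp only [Finset.mem_filter, Finset.mem_powersetCard, Finset.subset_univ, true_and]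
    exact and_comm
  rw [hfilter, Finset.sum_congr rfl fun t ht => by rw [(Finset.mem_powersetCard.1 ht).2],
    Finset.sum_const, Finset.card_powersetCard, nsmul_eq_mul]

theorem IsExpansion.evalAt_eq {z : HC'} {p : Fin 4 → (ZMod 2)[X]} (h : IsExpansion z p)
    (I : Finset (Fin 4)) :
    evalAt I z =
      1 + ∑ i : Fin 4, (I.card.choose (i + 1) : (ZMod 2)[X]) * X ^ (i + 1 : ℕ) * p i := by
  rw [h, map_add, map_one, map_sum]
  simp only [map_mul, evalAt_s, evalAt_aeval_y]

/-- The coefficients of an expansion, computed at the points with `1`, `2`, `3` and `4` nonzero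
coordinates. -/
theorem IsExpansion.coeff_eq {z : HC'} {p : Fin 4 → (ZMod 2)[X]} (h : IsExpansion z p)
    {I₁ I₂ I₃ I₄ : Finset (Fin 4)} (h₁ : I₁.card = 1) (h₂ : I₂.card = 2) (h₃ : I₃.card = 3)
    (h₄ : I₄.card = 4) :
    X * p 0 = 1 + evalAt I₁ z ∧ X ^ 2 * p 1 = 1 + evalAt I₂ z ∧
      X ^ 3 * p 2 = 1 + X * p 0 + X ^ 2 * p 1 + evalAt I₃ z ∧ X ^ 4 * p 3 = 1 + evalAt I₄ z := by
  have two : (2 : (ZMod 2)[X]) = 0 := CharTwo.two_eq_zero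
  have e1 := h.evalAt_eq I₁
  have e2 := h.evalAt_eq I₂
  have e3 := h.evalAt_eq I₃
  have e4 := h.evalAt_eq I₄
  simp only [h₁, h₂, h₃, h₄, Fin.sum_univ_four] at e1 e2 e3 e4
  norm_num [Nat.choose] at e1 e2 e3 e4
  refine ⟨?_, ?_, ?_, ?_⟩
  · linear_combination -e1 - two
  · linear_combination -e2 - two * (1 + X * p 0)
  · linear_combination -e3 - two * (1 + 2 * X * p 0 + 2 * X ^ 2 * p 1)
  · linear_combination -e4 - two * (1 + 2 * X * p 0 + 3 * X ^ 2 * p 1 +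
      2 * X ^ 3 * p 2)

/-- The coefficients of an expansion are unique. -/
theorem IsExpansion.unique {z : HC'} {p p' : Fin 4 → (ZMod 2)[X]} (h : IsExpansion z p)
    (h' : IsExpansion z p') : p = p' := by
  have card (k : ℕ) (hk : k ≤ 4) : ∃ I : Finset (Fin 4), I.card = k := by
    obtain ⟨I, -, hI⟩ := Finset.exists_subset_card_eq (s := (Finset.univ : Finset (Fin 4))) hk
    exact ⟨I, hI⟩
  obtain ⟨I₁, h₁⟩ := card 1 (by norm_num)
  obtain ⟨I₂, h₂⟩ := card 2 (by norm_num)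
  obtain ⟨I₃, h₃⟩ := card 3 (by norm_num)
  obtain ⟨I₄, h₄⟩ := card 4 (by norm_num)
  obtain ⟨e0, e1, e2, e3⟩ := h.coeff_eq h₁ h₂ h₃ h₄
  obtain ⟨e0', e1', e2', e3'⟩ := h'.coeff_eq h₁ h₂ h₃ h₄
  have hX (k : ℕ) : (X : (ZMod 2)[X]) ^ k ≠ 0 := pow_ne_zero k X_ne_zero
  have f0 : p 0 = p' 0 := mul_left_cancel₀ X_ne_zero (e0.trans e0'.symm)
  have f1 : p 1 = p' 1 := mul_left_cancel₀ (hX 2) (e1.trans e1'.symm)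
  have f2 : p 2 = p' 2 := mul_left_cancel₀ (hX 3) (by rw [e2, e2', f0, f1])
  have f3 : p 3 = p' 3 := mul_left_cancel₀ (hX 4) (e3.trans e3'.symm)
  funext i
  fin_cases i <;> assumption

/-! ### Expansion of symmetric polynomials -/

section

variable {R : Type} [CommRing R] [Algebra (ZMod 2) R] (φ : HC →+* R) {c : R}

theorem map_X_pow_succ (hφ : ∀ i, φ (MvPolynomial.X i) ^ 2 + φ (MvPolynomial.X i) * c = 0)
    (i : Fin 4) (k : ℕ) :
    φ (MvPolynomial.X i) ^ (k + 1) = φ (MvPolynomial.X i) * c ^ k := by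
  have two : (2 : R) = 0 := by
    have := congrArg (algebraMap (ZMod 2) R) (CharTwo.two_eq_zero : (2 : ZMod 2) = 0)
    simpa only [map_ofNat, map_zero] using this
  induction k with
  | zero => simp
  | succ k ih =>
    rw [pow_succ, ih]
    linear_combination c ^ k * hφ i - two * (φ (MvPolynomial.X i) * c ^ (k + 1))

/-- In a ring where `x_i² = x_i c`, a monomial is the product of the variables that occur in it
times a power of `c`. The subtraction is truncated: variables that do not occur contribute `0`. -/
theorem map_monomial_eq (hφ : ∀ i, φ (MvPolynomial.X i) ^ 2 + φ (MvPolynomial.X i) * c = 0)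
    (a : Fin 4 →₀ ℕ) (r : ZMod 2) :
    φ (MvPolynomial.monomial a r) =
      (∏ i ∈ a.support, φ (MvPolynomial.X i)) * aeval c (C r * X ^ ∑ i, (a i - 1)) := by
  have hr : φ (MvPolynomial.C r) = algebraMap (ZMod 2) R r :=
    RingHom.congr_fun (Subsingleton.elim (φ.comp MvPolynomial.C) _) r
  have hprod : ∏ i, c ^ (a i - 1) = ∏ i ∈ a.support, c ^ (a i - 1) := by
    symm
    refine Finset.prod_subset (Finset.subset_univ _) fun i _ hi => ?_
    rw [Finsupp.notMem_support_iff.1 hi, Nat.zero_sub, pow_zero]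
  rw [MvPolynomial.monomial_eq, map_mul, hr, map_mul, aeval_C, map_pow, aeval_X,
    ← Finset.prod_pow_eq_pow_sum, hprod, mul_left_comm, ← Finset.prod_mul_distrib, Finsupp.prod,
    map_prod]
  congr 1
  refine Finset.prod_congr rfl fun i hi => ?_
  obtain ⟨k, hk⟩ := Nat.exists_eq_succ_of_ne_zero (Finsupp.mem_support_iff.1 hi)
  rw [hk, map_pow, Nat.succ_eq_add_one, map_X_pow_succ φ hφ, Nat.add_sub_cancel]

end

/-- The coefficient in `𝔽₂[y]` of `∏_{i ∈ I} x_i` in the image of `f` in `H(C)'`: the sum over the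
monomials of `f` in which exactly the `x_i` with `i ∈ I` occur. -/
def squarefreeCoeff (f : HC) (I : Finset (Fin 4)) : (ZMod 2)[X] :=
  ∑ a ∈ f.support with a.support = I, C (f.coeff a) * X ^ ∑ i, (a i - 1)

theorem map_eq_sum_squarefreeCoeff {R : Type} [CommRing R] [Algebra (ZMod 2) R] (φ : HC →+* R)
    {c : R} (hφ : ∀ i, φ (MvPolynomial.X i) ^ 2 + φ (MvPolynomial.X i) * c = 0) (f : HC) :
    φ f = ∑ I : Finset (Fin 4),
      (∏ i ∈ I, φ (MvPolynomial.X i)) * aeval c (squarefreeCoeff f I) := by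
  conv_lhs => rw [f.as_sum, map_sum]
  rw [← Finset.sum_fiberwise f.support fun a => a.support]
  refine Finset.sum_congr rfl fun I _ => ?_
  rw [squarefreeCoeff, map_sum, Finset.mul_sum]
  refine Finset.sum_congr rfl fun a ha => ?_
  rw [map_monomial_eq φ hφ, (Finset.mem_filter.1 ha).2]

theorem squarefreeCoeff_map {f : HC} (hf : f.IsSymmetric) (π : Equiv.Perm (Fin 4))
    (I : Finset (Fin 4)) : squarefreeCoeff f (I.map π.toEmbedding) = squarefreeCoeff f I := by
  have hcoeff : ∀ a : Fin 4 →₀ ℕ, f.coeff (a.equivMapDomain π) = f.coeff a := by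
    intro a
    conv_lhs => rw [← hf π]
    rw [Finsupp.equivMapDomain_eq_mapDomain]
    exact MvPolynomial.coeff_rename_mapDomain π π.injective f a
  have hsupp : ∀ a : Fin 4 →₀ ℕ,
      (a.equivMapDomain π).support = I.map π.toEmbedding ↔ a.support = I := by
    intro a
    exact Finset.map_inj
  rw [squarefreeCoeff, squarefreeCoeff]
  refine (Finset.sum_equiv (Finsupp.equivCongrLeft π) (fun a => ?_) fun a _ => ?_).symm
  · change _ ↔ a.equivMapDomain π ∈ _
    simp only [Finset.mem_filter, MvPolynomial.mem_support_iff, hcoeff, hsupp]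
  · change _ = C (f.coeff (a.equivMapDomain π)) * X ^ ∑ i, (a.equivMapDomain π i - 1)
    rw [hcoeff, ← Equiv.sum_comp π fun i => a.equivMapDomain π i - 1]
    simp only [Finsupp.equivMapDomain_apply, Equiv.symm_apply_apply]

theorem squarefreeCoeff_eq_of_card_eq {f : HC} (hf : f.IsSymmetric) {I K : Finset (Fin 4)}
    (h : I.card = K.card) : squarefreeCoeff f I = squarefreeCoeff f K := by
  set π : Equiv.Perm (Fin 4) := (Finset.equivOfCardEq h).extendSubtype
  have hπ : I.map π.toEmbedding = K := by
    refine Finset.eq_of_subset_of_card_le (fun j hj => ?_) (by rw [Finset.card_map, h])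
    obtain ⟨i, hi, rfl⟩ := Finset.mem_map.1 hj
    exact (Finset.equivOfCardEq h).extendSubtype_mem i hi
  rw [← hπ, squarefreeCoeff_map hf]

/-- The expansion of a symmetric polynomial: the coefficients of the squarefree monomials of the
same degree agree. The coefficients `Q k` do not depend on the ring in which it takes place. -/
theorem exists_expansion {f : HC} (hf : f.IsSymmetric) :
    ∃ Q : ℕ → (ZMod 2)[X], ∀ {R : Type} [CommRing R] [Algebra (ZMod 2) R] (φ : HC →+* R) (c : R),
      (∀ i, φ (MvPolynomial.X i) ^ 2 + φ (MvPolynomial.X i) * c = 0) →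
      φ f = aeval c (Q 0) +
        ∑ i : Fin 4, φ (MvPolynomial.esymm (Fin 4) (ZMod 2) (i + 1)) * aeval c (Q (i + 1)) := by
  have hfac : Function.FactorsThrough (squarefreeCoeff f) (Finset.card : Finset (Fin 4) → ℕ) :=
    fun I K h => squarefreeCoeff_eq_of_card_eq hf h
  set Q : ℕ → (ZMod 2)[X] := Function.extend Finset.card (squarefreeCoeff f) 0
  have hQ : ∀ I, squarefreeCoeff f I = Q I.card := fun I => (hfac.extend_apply 0 I).symm
  refine ⟨Q, fun φ c hφ => ?_⟩
  have hsum : φ f = ∑ k ∈ Finset.range 5,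
      φ (MvPolynomial.esymm (Fin 4) (ZMod 2) k) * aeval c (Q k) := by
    rw [map_eq_sum_squarefreeCoeff φ hφ, ← Finset.powerset_univ, Finset.sum_powerset]
    refine Finset.sum_congr rfl fun k _ => ?_
    rw [MvPolynomial.esymm, map_sum, Finset.sum_mul]
    refine Finset.sum_congr rfl fun I hI => ?_
    rw [hQ, (Finset.mem_powersetCard.1 hI).2, map_prod]
  rw [hsum, Finset.sum_range_succ', MvPolynomial.esymm_zero, map_one, one_mul, add_comm,
    Fin.sum_univ_eq_sum_range fun k =>
      φ (MvPolynomial.esymm (Fin 4) (ZMod 2) (k + 1)) * aeval c (Q (k + 1))]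

theorem toHC'_X_sq (i : Fin 4) :
    toHC' (MvPolynomial.X i) ^ 2 + toHC' (MvPolynomial.X i) * y = 0 :=
  Ideal.Quotient.eq_zero_iff_mem.2 (Ideal.subset_span ⟨i, rfl⟩)

/-- The constant coefficient of the expansion is that of `f`, as one sees by mapping all variables
to `0`. -/
theorem exists_isExpansion {f : HC} (hf : f.IsSymmetric) (h1 : MvPolynomial.constantCoeff f = 1) :
    ∃ p, IsExpansion (toHC' f) p := by
  obtain ⟨Q, hQ⟩ := exists_expansion hf
  have hQ0 : Q 0 = 1 := by
    have h := hQ (C.comp MvPolynomial.constantCoeff) (X : (ZMod 2)[X]) (by simp)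
    rw [Finset.sum_eq_zero, add_zero, RingHom.comp_apply, h1, C_1, aeval_X_left_apply] at h
    · exact h.symm
    · intro k _
      have hk : MvPolynomial.constantCoeff (MvPolynomial.esymm (Fin 4) (ZMod 2) (k + 1)) = 0 := by
        rw [MvPolynomial.esymm, map_sum]
        refine Finset.sum_eq_zero fun t ht => ?_
        simp [map_prod, (Finset.mem_powersetCard.1 ht).2]
      rw [RingHom.comp_apply, hk, C_0, zero_mul]
  have h := hQ toHC' y toHC'_X_sq
  rw [hQ0] at h
  -- The ring structures on `H(C)'` in `h` and in `IsExpansion` agree by unfolding instances.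
  exact ⟨fun i => Q (i + 1), h.trans (congrArg (· + _) (map_one _))⟩

/-! ### The expansion of the Stiefel-Whitney class -/

section

variable {n : ℕ} (ρ : Cube →* GL (Fin n) ℝ)

/-- The value of `w(ρ)` at the point attached to `g`: a character contributes `1 + y` if it is
`-1` at `g`, and `1` otherwise. -/
theorem evalAt_totalSW (g : Cube) :
    evalAt (Finset.univ.filter fun i => g i = -1) (toHC' (totalSW ρ)) =
      (1 + X) ^ negMult ρ g := by
  obtain ⟨b, J, h⟩ := exists_isEigenbasis ρ
  have hsum : ∀ K : Finset (Fin 4), ∑ i ∈ K, (if g i = -1 then (X : (ZMod 2)[X]) else 0) =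
      C (signBit (cubeChar K g)) * X := by
    intro K
    rw [cubeChar_apply]
    induction K using Finset.induction_on with
    | empty => simp [signBit_one]
    | insert i K hi ih =>
      rw [Finset.sum_insert hi, Finset.prod_insert hi, ih, signBit_mul, C_add, add_mul]
      congr 1
      rcases Int.units_eq_one_or (g i) with h | h <;> simp [h, signBit]
  rw [h.totalSW_eq, evalAt_toHC', map_prod, h.negMult_eq, ← Finset.prod_const, Finset.prod_filter]
  refine Finset.prod_congr rfl fun j _ => ?_
  simp only [map_add, map_one, map_sum, MvPolynomial.coe_eval₂Hom, MvPolynomial.eval₂_X,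
    Finset.mem_filter, Finset.mem_univ, true_and, hsum]
  rcases Int.units_eq_one_or (cubeChar (J j) g) with h | h <;> simp [h, signBit]

variable {ρ}

theorem IsSymmetricCharacter.isSymmetric_totalSW (hρ : IsSymmetricCharacter ρ) :
    (totalSW ρ).IsSymmetric := by
  intro π
  rw [totalSW, map_prod]
  conv_rhs => rw [← Equiv.prod_comp (Equiv.finsetCongr π)]
  refine Finset.prod_congr rfl fun K _ => ?_
  rw [Equiv.finsetCongr_apply, hρ.charMult_map, Finset.sum_map]
  simp

theorem IsSymmetricCharacter.exists_isExpansion_totalSW (hρ : IsSymmetricCharacter ρ) :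
    ∃ p, IsExpansion (toHC' (totalSW ρ)) p := by
  refine exists_isExpansion hρ.isSymmetric_totalSW ?_
  simp [totalSW]

end

end SW

end

theorem theorem10 {n : ℕ} (ρ : SW.Cube →* GL (Fin n) ℝ) (hρ : SW.IsSymmetricCharacter ρ) :
    (∀ c : SW.Cochain (GL (Fin n) ℝ), SW.IsUniversalStiefelWhitney n c →
      SW.Cohomologous (SW.pullback (SW.toContinuous ρ) c) (SW.toCochain (SW.totalSW ρ))) ∧
    (∃! p : Fin 4 → (ZMod 2)[X], SW.IsExpansion (SW.toHC' (SW.totalSW ρ)) p) ∧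
    ∀ p : Fin 4 → (ZMod 2)[X], SW.IsExpansion (SW.toHC' (SW.totalSW ρ)) p →
      ∀ g₁ g₂ g₃ g₄ : SW.Cube,
        SW.deg g₁ = 1 → SW.deg g₂ = 2 → SW.deg g₃ = 3 → SW.deg g₄ = 4 →
        X * p 0 = 1 + (1 + X) ^ SW.negMult ρ g₁ ∧
        X ^ 2 * p 1 = 1 + (1 + X) ^ SW.negMult ρ g₂ ∧
        X ^ 3 * p 2 = 1 + X * p 0 + X ^ 2 * p 1 + (1 + X) ^ SW.negMult ρ g₃ ∧
        X ^ 4 * p 3 = 1 + (1 + X) ^ SW.negMult ρ g₄ := by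
  refine ⟨fun c hc => SW.cohomologous_pullback_universal ρ hc, ?_, ?_⟩
  · obtain ⟨p, hp⟩ := hρ.exists_isExpansion_totalSW
    exact ⟨p, hp, fun p' hp' => hp'.unique hp⟩
  · intro p hp g₁ g₂ g₃ g₄ h₁ h₂ h₃ h₄
    simpa only [SW.evalAt_totalSW] using hp.coeff_eq h₁ h₂ h₃ h₄
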